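/- An instance of the Unanimous Vote problem consists of $n \ge 1$ independent coins with known probabilities of heads $p_1,\dots,p_n \in [0,1]$. Coins are flipped one at a time, each at most once, until both a head and a tail have been observed or all $n$ coins have been flipped. An ordering (non-adaptive) fixes the sequence of coins in advance; an adaptive strategy may choose the next coin depending on the outcomes observed so far. The cost of an ordering or strategy is its expected number of flips. Let $\mathrm{OPT}_{\mathrm{NA}}(p)$ and $\mathrm{OPT}_{\mathrm{AD}}(p)$ be the minimum cost over all orderings and over all adaptive strategies, respectively, and let $$\mathrm{gap}(n) = \sup_{p \in [0,1]^n} \frac{\mathrm{OPT}_{\mathrm{NA}}(p)}{\mathrm{OPT}_{\mathrm{AD}}(p)}$$ be the adaptivity gap for $n$ coins. Theorem. $\mathrm{gap}(n) = 1.2 \pm O(2^{-n})$. That is, there is an absolute constant $C$ such that for all $n \ge 1$ the supremum above is finite and $$1.2 - \frac{C}{2^n} \;\le\; \mathrm{gap}(n) \;\le\; 1.2 + \frac{C}{2^n}.$$ Moreover, the lower bound is witnessed by one coin with $p=0$ and $n-1$ coins with $p=\tfrac12$: the ratio $\mathrm{OPT}_{\mathrm{NA}}/\mathrm{OPT}_{\mathrm{AD}}$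 of this instance is at least $1.2 - C/2^n$. -/

import Mathlib

namespace UnanimousVote

/-- An outcome of the `n` coins: `true` is heads, `false` is tails. -/
abbrev Outcome (n : ℕ) : Type := Fin n → Bool

/-- Probability of the outcome `ω` when the coins are flipped independently and coin `i` has
probability of heads `p i`. -/
noncomputable def outcomeProb {n : ℕ} (p : Fin n → unitInterval) (ω : Outcome n) : ℝ :=
  ∏ i, if ω i then (p i : ℝ) else 1 - (p i : ℝ)

/-- Expectation of `X` over the outcome of the independent coins. -/
noncomputable def expect {n : ℕ} (p : Fin n → unitInterval) (X : Outcome n → ℕ) : ℝ :=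
  ∑ ω, outcomeProb p ω * (X ω : ℝ)

/-- The coin in position `j` of the ordering `a` is flipped iff the coins in the earlier positions
do not already show both a head and a tail. -/
def Reaches {n : ℕ} (a : Equiv.Perm (Fin n)) (ω : Outcome n) (j : Fin n) : Prop :=
  ¬ ((∃ i < j, ω (a i) = true) ∧ (∃ i < j, ω (a i) = false))

open Classical in
/-- Number of coins flipped when the coins are flipped in the order `a 0, a 1, …` until both a head
and a tail have been observed or all coins have been flipped. -/
noncomputable def orderingFlips {n : ℕ} (a : Equiv.Perm (Fin n)) (ω : Outcome n) : ℕ :=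
  (Finset.univ.filter fun j => Reaches a ω j).card

/-- Cost of a (non-adaptive) ordering: its expected number of flips. -/
noncomputable def orderingCost {n : ℕ} (p : Fin n → unitInterval) (a : Equiv.Perm (Fin n)) : ℝ :=
  expect p (orderingFlips a)

/-- Minimum cost of a non-adaptive ordering. -/
noncomputable def optNonadaptive {n : ℕ} (p : Fin n → unitInterval) : ℝ :=
  ⨅ a : Equiv.Perm (Fin n), orderingCost p a

/-- A (deterministic) adaptive strategy for the set `S` of coins not flipped so far: it names the
next coin of `S` to flip and, for each of its two outcomes, a strategy for the coins left. -/
inductive Strategy {n : ℕ} : Finset (Fin n) → Type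
  | done {S : Finset (Fin n)} (hS : S = ∅) : Strategy S
  | flip {S : Finset (Fin n)} (i : Fin n) (hi : i ∈ S)
      (onHeads onTails : Strategy (S.erase i)) : Strategy S

/-- Number of further flips of a strategy on the outcome `ω`, where `sawHead` and `sawTail` record
whether a head and a tail have been observed so far. The process stops as soon as both have been
observed, or when no coin is left. -/
def Strategy.flips {n : ℕ} (ω : Outcome n) :
    {S : Finset (Fin n)} → Strategy S → (sawHead sawTail : Bool) → ℕ
  | _, .done _, _, _ => 0
  | _, .flip i _ onHeads onTails, sawHead, sawTail =>
      if sawHead && sawTail then 0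
      else 1 + if ω i then onHeads.flips ω true sawTail else onTails.flips ω sawHead true

/-- Cost of an adaptive strategy for all `n` coins: its expected number of flips. -/
noncomputable def strategyCost {n : ℕ} (p : Fin n → unitInterval)
    (s : Strategy (Finset.univ : Finset (Fin n))) : ℝ :=
  expect p fun ω => s.flips ω false false

/-- Minimum cost of an adaptive strategy. -/
noncomputable def optAdaptive {n : ℕ} (p : Fin n → unitInterval) : ℝ :=
  ⨅ s : Strategy (Finset.univ : Finset (Fin n)), strategyCost p s

/-- Ratio of the optimal non-adaptive cost to the optimal adaptive cost of the instance `p`. -/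
noncomputable def gapRatio {n : ℕ} (p : Fin n → unitInterval) : ℝ :=
  optNonadaptive p / optAdaptive p

/-- The adaptivity gap of the Unanimous Vote problem with `n` coins: the worst-case ratio over all
instances. -/
noncomputable def adaptivityGap (n : ℕ) : ℝ :=
  ⨆ p : Fin n → unitInterval, gapRatio p

/-- The instance in which one coin never shows heads and the other `n - 1` coins are fair. -/
noncomputable def oneTailsInstance (n : ℕ) : Fin n → unitInterval := fun i =>
  if i.val = 0 then 0 else ⟨1 / 2, by norm_num, by norm_num⟩

/-- Every set of coins has an adaptive strategy, so the infimum over strategies is not vacuous. -/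
theorem Strategy.nonempty {n : ℕ} (S : Finset (Fin n)) : Nonempty (Strategy S) := by
  induction S using Finset.strongInduction with
  | H S ih =>
    rcases S.eq_empty_or_nonempty with rfl | ⟨i, hi⟩
    · exact ⟨.done rfl⟩
    · obtain ⟨s⟩ := ih _ (Finset.erase_ssubset hi)
      exact ⟨.flip i hi s s⟩

/-- Expected numbers of flips are nonnegative, so the infima defining the optimal costs are those
of nonempty sets bounded below. -/
theorem expect_nonneg {n : ℕ} (p : Fin n → unitInterval) (X : Outcome n → ℕ) :
    0 ≤ expect p X := by
  refine Finset.sum_nonneg fun ω _ => mul_nonneg (Finset.prod_nonneg fun i _ => ?_) (by positivity)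
  split
  · exact (p i).2.1
  · linarith [(p i).2.2]

end UnanimousVote

namespace UnanimousVote

/-! After its first flip `x`, an adaptive strategy only waits for the opposite outcome. Its best
cost is `firstCost`, built from two one-sided search costs (`oracleCost`), each attained by sorting
the coins. Let `c` and `d` be the remaining coins least and most likely to show heads, `a` the heads
probability of `c`, `b` the tails probability of `d`, and `T` the other coins, with search costs `u`
and `v` on the two sides. Then `firstCost` is at least `2 + p * a * u + (1 - p) * b * v`, where `p`
is the heads probability of `x`.

An ordering may flip `x`, `c`, `d` first, in the best arrangement, and then `T`. Its cost is `2 + M`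
plus the two search costs of one common order of `T`, weighted by `P = p * a * (1 - b)` and `Q = (1
- p) * b * (1 - a)`; here `M` is the least probability that two of the three coins agree. Two common
orders are used: the greedy one exceeds both optima by at most `4 / 3 * √(P * Q)` in total
(`exists_list_greedy`), and the one sorted for the second side pays at most `K` on the first, where
`K` bounds `1 / b`. With `u` and `v` bounded below by geometric sums, everything is affine in `p`
except the piecewise affine `M`, so the ratio `6 / 5` reduces to polynomial inequalities in `a` and
`b` at the breakpoints of `M` (`nonadaptive_le_of_le`).

The bound is tight at `a = 0`, `b = p = 1 / 2`: one coin that never shows heads, the others fair.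
Every ordering then costs `3 - 4 / 2 ^ n`, while `5 / 2` suffices adaptively. In the upper bound,
truncating the geometric series causes the exponentially small error. -/

/-! ### The numerical inequality in the three extreme probabilities. -/

theorem affine_le {m c d p x y : ℝ} (hx : m ≤ c + d * x) (hy : m ≤ c + d * y) (hxp : x ≤ p)
    (hpy : p ≤ y) : m ≤ c + d * p := by
  rcases le_total 0 d with hd | hd
  · linarith [mul_le_mul_of_nonneg_left hxp hd]
  · linarith [mul_le_mul_of_nonpos_left hpy hd]

/-- The affine function `c + d * p` dominates, at the breakpoints `0, a, 1 - b, 1`, the least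
agreement probability among the pairs of three coins with probabilities of heads `a, p, 1 - b`. -/
def CornerBound (a b c d : ℝ) : Prop :=
  b ≤ c ∧ a * (1 - b) + b * (1 - a) ≤ c + d * a ∧
    a * (1 - b) + b * (1 - a) ≤ c + d * (1 - b) ∧ a ≤ c + d

/-- The analogue of `CornerBound` for `1 / 2 ≤ b`, where the breakpoints are `0, a, 1 / 2, 1`. -/
def HalfCornerBound (a b c d : ℝ) : Prop :=
  a * (1 - b) + b * (1 - a) ≤ c ∧ a * (1 - b) + b * (1 - a) ≤ c + d * a ∧
    1 / 2 ≤ c + d * (1 / 2) ∧ a ≤ c + d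

/-- Between consecutive breakpoints a single one of the three bounds on `M` is enough, and two
affine functions of `p` need only be compared at the endpoints. The breakpoints `a` and `1 - b` are
where the second and the first bound meet the constant third one. -/
theorem CornerBound.le {a b p c d M : ℝ} (h : CornerBound a b c d) (hp : 0 ≤ p) (hp1 : p ≤ 1)
    (hm1 : M ≤ p * a + (1 - p) * (1 - a)) (hm2 : M ≤ p * (1 - b) + (1 - p) * b)
    (hm3 : M ≤ a * (1 - b) + b * (1 - a)) : M ≤ c + d * p := by
  obtain ⟨h0, h1, h2, h3⟩ := h
  rcases le_total p a with hpa | hpa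
  · have := affine_le (m := 0) (c := c - b) (d := d - (1 - 2 * b)) (x := 0) (y := a) (p := p)
      (by linarith) (by linarith) hp hpa
    linarith
  rcases le_total p (1 - b) with hpb | hpb
  · exact hm3.trans (affine_le h1 h2 hpa hpb)
  · have := affine_le (m := 0) (c := c - (1 - a)) (d := d + (1 - 2 * a)) (x := 1 - b) (y := 1)
      (p := p) (by linarith) (by linarith) hpb hp1
    linarith

theorem HalfCornerBound.le {a b p c d M : ℝ} (h : HalfCornerBound a b c d) (hp : 0 ≤ p)
    (hp1 : p ≤ 1) (hm1 : M ≤ p * a + (1 - p) * (1 - a)) (hm2 : M ≤ p * (1 - b) + (1 - p) * b)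
    (hm3 : M ≤ a * (1 - b) + b * (1 - a)) : M ≤ c + d * p := by
  obtain ⟨h0, h1, h2, h3⟩ := h
  rcases le_total p a with hpa | hpa
  · exact hm3.trans (affine_le (by linarith) h1 hp hpa)
  rcases le_total p (1 / 2) with hpb | hpb
  · have := affine_le (m := 0) (c := c - b) (d := d - (1 - 2 * b)) (x := a) (y := 1 / 2) (p := p)
      (by linarith) (by linarith) hpa hpb
    linarith
  · have := affine_le (m := 0) (c := c - (1 - a)) (d := d + (1 - 2 * a)) (x := 1 / 2) (y := 1)
      (p := p) (by linarith) (by linarith) hpb hp1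
    linarith

/-- With `sqrtSlope`, the affine function of `p` that bounds the admissible agreement probability
when the remaining coins are flipped greedily. -/
noncomputable def sqrtConst (a b W : ℝ) : ℝ :=
  2 / 5 + b * (a + 1 / 5) * W - 4 / 9 * (b * (1 - a))

noncomputable def sqrtSlope (a b U W : ℝ) : ℝ :=
  a * (b + 1 / 5) * U - b * (a + 1 / 5) * W - a * (1 - b) + 4 / 9 * (b * (1 - a))

/-- With `linSlope`, the affine function of `p` that bounds the admissible agreement probability
when the remaining coins are flipped in order of increasing probability of tails. -/
noncomputable def linConst (a b W : ℝ) : ℝ :=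
  2 / 5 + b * (a + 1 / 5) * W

noncomputable def linSlope (a b K U W : ℝ) : ℝ :=
  6 / 5 * (a * U) - b * (a + 1 / 5) * W - K * (a * (1 - b))

/-- Here and in the next five lemmas the endpoint conditions are polynomial inequalities on a small
region of the `(a, b)` plane, certified by products of its constraints. The arguments in place of
`U` and `W` are affine minorants of the search costs. -/
theorem cornerBound_of_le_quarter {a b : ℝ} (h0 : 0 ≤ a) (h1 : 0 ≤ b - a) (h2 : 0 ≤ 1 / 4 - b) :
    CornerBound a b (sqrtConst a b (1 + b)) (sqrtSlope a b (1 + a) (1 + b)) := by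
  simp only [CornerBound, sqrtConst, sqrtSlope]
  refine ⟨?_, ?_, ?_, ?_⟩ <;>
    nlinarith [mul_nonneg h0 h0, mul_nonneg h0 h1, mul_nonneg h0 h2, mul_nonneg h1 h1,
      mul_nonneg h1 h2, mul_nonneg h2 h2]

theorem cornerBound_of_le_third {a b : ℝ} (h0 : 0 ≤ a) (h1 : 0 ≤ b - a)
    (h2 : 0 ≤ b - 1 / 4) (h3 : 0 ≤ 1 / 3 - b) :
    CornerBound a b (sqrtConst a b (91 / 100 + 8 / 5 * b))
      (sqrtSlope a b (91 / 100 + 8 / 5 * a) (91 / 100 + 8 / 5 * b)) := by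
  simp only [CornerBound, sqrtConst, sqrtSlope]
  refine ⟨?_, ?_, ?_, ?_⟩ <;>
    nlinarith [mul_nonneg h0 h0, mul_nonneg h0 h1, mul_nonneg h0 h2, mul_nonneg h0 h3,
      mul_nonneg h1 h1, mul_nonneg h1 h2, mul_nonneg h1 h3, mul_nonneg h2 h2, mul_nonneg h2 h3,
      mul_nonneg h3 h3]

theorem cornerBound_of_le_two_fifths {a b : ℝ} (h0 : 0 ≤ a - 3 / 20) (h1 : 0 ≤ b - a)
    (h2 : 0 ≤ b - 1 / 3) (h3 : 0 ≤ 2 / 5 - b) :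
    CornerBound a b (sqrtConst a b (87 / 100 + 43 / 25 * b))
      (sqrtSlope a b (1 + a) (87 / 100 + 43 / 25 * b)) := by
  simp only [CornerBound, sqrtConst, sqrtSlope]
  refine ⟨?_, ?_, ?_, ?_⟩ <;>
    nlinarith [mul_nonneg h0 h0, mul_nonneg h0 h1, mul_nonneg h0 h2, mul_nonneg h0 h3,
      mul_nonneg h1 h1, mul_nonneg h1 h2, mul_nonneg h1 h3, mul_nonneg h2 h2, mul_nonneg h2 h3,
      mul_nonneg h3 h3]

theorem cornerBound_of_le_two_fifths_of_small {a b : ℝ} (h0 : 0 ≤ a) (h1 : 0 ≤ 3 / 20 - a)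
    (h2 : 0 ≤ b - 1 / 3) (h3 : 0 ≤ 2 / 5 - b) :
    CornerBound a b (linConst a b (87 / 100 + 43 / 25 * b))
      (linSlope a b 3 (1 + a) (87 / 100 + 43 / 25 * b)) := by
  simp only [CornerBound, linConst, linSlope]
  refine ⟨?_, ?_, ?_, ?_⟩ <;>
    nlinarith [mul_nonneg h0 h0, mul_nonneg h0 h1, mul_nonneg h0 h2, mul_nonneg h0 h3,
      mul_nonneg h1 h1, mul_nonneg h1 h2, mul_nonneg h1 h3, mul_nonneg h2 h2, mul_nonneg h2 h3,
      mul_nonneg h3 h3]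

/-- The tight point `a = 0`, `b = 1 / 2` lies here. It leaves no room for the greedy loss `4 / 9 *
(b * (1 - a))`, so the sorted order is used; `4 * b` is the tangent to `1 / (1 - b)` at `1 / 2`. -/
theorem cornerBound_of_le_half {a b : ℝ} (h0 : 0 ≤ a) (h1 : 0 ≤ b - a)
    (h2 : 0 ≤ b - 2 / 5) (h3 : 0 ≤ 1 / 2 - b) :
    CornerBound a b (linConst a b (4 * b)) (linSlope a b (5 / 2) (1 + a) (4 * b)) := by
  simp only [CornerBound, linConst, linSlope]
  refine ⟨?_, ?_, ?_, ?_⟩ <;>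
    nlinarith [mul_nonneg h0 h0, mul_nonneg h0 h1, mul_nonneg h0 h2, mul_nonneg h0 h3,
      mul_nonneg h1 h1, mul_nonneg h1 h2, mul_nonneg h1 h3, mul_nonneg h2 h2, mul_nonneg h2 h3,
      mul_nonneg h3 h3]

theorem cornerBound_of_half_le {a b : ℝ} (h0 : 0 ≤ a) (h1 : 0 ≤ 1 - b - a) (h2 : 0 ≤ b - 1 / 2) :
    HalfCornerBound a b (linConst a b (3 * b + 1 / 2)) (linSlope a b 2 (1 + a) (3 * b + 1 / 2)) := by
  simp only [HalfCornerBound, linConst, linSlope]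
  refine ⟨?_, ?_, ?_, ?_⟩ <;>
    nlinarith [mul_nonneg h0 h0, mul_nonneg h0 h1, mul_nonneg h0 h2, mul_nonneg h1 h1,
      mul_nonneg h1 h2, mul_nonneg h2 h2]

/-- The affine function bounding `M` is exactly what the target leaves for `M` after the other terms
of `N`, with `u`, `v` replaced by `U`, `W`. The coefficient of `v` in it is at most `2`, which gives
the error `2 * ε`. -/
theorem le_of_sqrtConst {a b p u v ε U W M N : ℝ} (ha : 0 ≤ a) (hb : 0 ≤ b) (ha1 : a ≤ 1)
    (hb1 : b ≤ 1) (hp : 0 ≤ p) (hp1 : p ≤ 1) (hε : 0 ≤ ε) (hU : U ≤ u) (hW : W ≤ v + ε)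
    (hM : M ≤ sqrtConst a b W + sqrtSlope a b U W * p)
    (hN : N ≤ 2 + M + (p * a * (1 - b)) * u + ((1 - p) * b * (1 - a)) * v
      + ((p * a * (1 - b)) + 4 / 9 * ((1 - p) * b * (1 - a)))) :
    N ≤ 6 / 5 * (2 + p * a * u + (1 - p) * b * v) + 2 * ε := by
  have h1 : 0 ≤ p * a * (b + 1 / 5) * (u - U) := by
    have := sub_nonneg.2 hU; positivity
  have hq : 0 ≤ 1 - p := by linarith
  have h2 : 0 ≤ (1 - p) * b * (a + 1 / 5) * (v + ε - W) := by
    have := sub_nonneg.2 hW; positivity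
  have h3 : (1 - p) * b * (a + 1 / 5) ≤ 1 * 1 * 2 := by
    gcongr <;> linarith
  have h4 := mul_le_mul_of_nonneg_right h3 hε
  simp only [sqrtConst, sqrtSlope] at hM
  linarith

theorem le_of_linConst {a b p u v ε U W M N K : ℝ} (ha : 0 ≤ a) (hb : 0 ≤ b) (ha1 : a ≤ 1)
    (hb1 : b ≤ 1) (hp : 0 ≤ p) (hp1 : p ≤ 1) (hε : 0 ≤ ε) (hU : U ≤ u) (hW : W ≤ v + ε)
    (hM : M ≤ linConst a b W + linSlope a b K U W * p)
    (hN : N ≤ 2 + M + K * (p * a * (1 - b)) + ((1 - p) * b * (1 - a)) * v) :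
    N ≤ 6 / 5 * (2 + p * a * u + (1 - p) * b * v) + 2 * ε := by
  have h1 : 0 ≤ p * a * (u - U) := by
    have := sub_nonneg.2 hU; positivity
  have hq : 0 ≤ 1 - p := by linarith
  have h2 : 0 ≤ (1 - p) * b * (a + 1 / 5) * (v + ε - W) := by
    have := sub_nonneg.2 hW; positivity
  have h3 : (1 - p) * b * (a + 1 / 5) ≤ 1 * 1 * 2 := by
    gcongr <;> linarith
  have h4 := mul_le_mul_of_nonneg_right h3 hε
  simp only [linConst, linSlope] at hM
  linarith

/-- The numerical inequality between a non-adaptive cost `N` and the adaptive lower bound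
`2 + p * a * u + (1 - p) * b * v`, where `M` is the least agreement probability of two among three
coins and `u`, `v` are the oracle costs of the remaining coins. -/
theorem nonadaptive_le_of_le {a b p u v ε M N : ℝ} (ha : 0 ≤ a) (hab : a ≤ b) (hab1 : a + b ≤ 1)
    (hp : 0 ≤ p) (hp1 : p ≤ 1) (hε : 0 ≤ ε)
    (hu : 1 + a + a ^ 2 ≤ u) (hv : 1 + b + b ^ 2 ≤ v)
    (hv' : b ≤ 1 / 2 → 4 * b ≤ v + ε) (hv'' : 1 / 2 ≤ b → 3 * b + 1 / 2 ≤ v + ε)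
    (hm1 : M ≤ p * a + (1 - p) * (1 - a)) (hm2 : M ≤ p * (1 - b) + (1 - p) * b)
    (hm3 : M ≤ a * (1 - b) + b * (1 - a))
    (hsqrt : N ≤ 2 + M + (p * a * (1 - b)) * u + ((1 - p) * b * (1 - a)) * v
      + ((p * a * (1 - b)) + 4 / 9 * ((1 - p) * b * (1 - a))))
    (hlin : ∀ K : ℝ, 0 < K → 1 - b ≤ 1 - 1 / K →
      N ≤ 2 + M + K * (p * a * (1 - b)) + ((1 - p) * b * (1 - a)) * v) :
    N ≤ 6 / 5 * (2 + p * a * u + (1 - p) * b * v) + 2 * ε := by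
  have hb : 0 ≤ b := ha.trans hab
  have ha1 : a ≤ 1 := by linarith
  have hb1 : b ≤ 1 := by linarith
  have hu1 : 1 + a ≤ u := by nlinarith
  rcases le_total b (1 / 4) with h4 | h4
  · refine le_of_sqrtConst ha hb ha1 hb1 hp hp1 hε hu1 ?_ ((cornerBound_of_le_quarter ha
      (by linarith) (by linarith)).le hp hp1 hm1 hm2 hm3) hsqrt
    nlinarith
  rcases le_total b (1 / 3) with h3 | h3
  · refine le_of_sqrtConst ha hb ha1 hb1 hp hp1 hε ?_ ?_ ((cornerBound_of_le_third ha
      (by linarith) (by linarith) (by linarith)).le hp hp1 hm1 hm2 hm3) hsqrt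
    -- `91 / 100 + 8 / 5 * t` is the tangent to `1 + t + t ^ 2` at `3 / 10`.
    · nlinarith [sq_nonneg (a - 3 / 10)]
    · nlinarith [sq_nonneg (b - 3 / 10)]
  rcases le_total b (2 / 5) with h25 | h25
  -- Tangent to `1 + b + b ^ 2` at `9 / 25`, with the constant rounded down.
  · have hW : 87 / 100 + 43 / 25 * b ≤ v + ε := by nlinarith [sq_nonneg (b - 9 / 25)]
    rcases le_total a (3 / 20) with hsmall | hsmall
    -- In each use of `hlin`, `K` is the reciprocal of the lower end of the range of `b`.
    · exact le_of_linConst ha hb ha1 hb1 hp hp1 hε hu1 hW ((cornerBound_of_le_two_fifths_of_small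
        ha (by linarith) (by linarith) (by linarith)).le hp hp1 hm1 hm2 hm3)
        (hlin 3 (by norm_num) (by linarith))
    · exact le_of_sqrtConst ha hb ha1 hb1 hp hp1 hε hu1 hW ((cornerBound_of_le_two_fifths
        (by linarith) (by linarith) (by linarith) (by linarith)).le hp hp1 hm1 hm2 hm3) hsqrt
  rcases le_total b (1 / 2) with h2 | h2
  · exact le_of_linConst ha hb ha1 hb1 hp hp1 hε hu1 (hv' h2) ((cornerBound_of_le_half
        ha (by linarith) (by linarith) (by linarith)).le hp hp1 hm1 hm2 hm3)
        (hlin (5 / 2) (by norm_num) (by norm_num; linarith))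
  · exact le_of_linConst ha hb ha1 hb1 hp hp1 hε hu1 (hv'' h2) ((cornerBound_of_half_le
        ha (by linarith) (by linarith)).le hp hp1 hm1 hm2 hm3)
        (hlin 2 (by norm_num) (by norm_num; linarith))

/-! ### One-sided search and the greedy compromise between the two sides. -/

section Oracle

variable {ι : Type*}

/-- Expected number of flips when the coins of the list are flipped in order until a tail. -/
def chain (p : ι → ℝ) : List ι → ℝ
  | [] => 0
  | i :: l => 1 + p i * chain p l

theorem chain_nonneg {p : ι → ℝ} (hp : ∀ i, 0 ≤ p i) (l : List ι) : 0 ≤ chain p l := by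
  induction l with
  | nil => exact le_rfl
  | cons i l ih => simp only [chain]; have := mul_nonneg (hp i) ih; linarith

theorem chain_le_length {p : ι → ℝ} (hp : ∀ i, 0 ≤ p i) (hp1 : ∀ i, p i ≤ 1) (l : List ι) :
    chain p l ≤ l.length := by
  induction l with
  | nil => simp [chain]
  | cons i l ih =>
    simp only [chain, List.length_cons, Nat.cast_add, Nat.cast_one]
    have := mul_le_mul (hp1 i) ih (chain_nonneg hp l) zero_le_one
    linarith

/-- `K` is the fixed point of `t ↦ 1 + (1 - 1 / K) * t`, the mean of a geometric waiting time. -/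
theorem chain_le_of_forall_le {p : ι → ℝ} {K : ℝ} (hK : 0 < K) {l : List ι}
    (h : ∀ i ∈ l, p i ≤ 1 - 1 / K) (hp : ∀ i, 0 ≤ p i) : chain p l ≤ K := by
  induction l with
  | nil => exact hK.le
  | cons i l ih =>
    simp only [chain]
    have h1 := mul_le_mul (h i (by simp)) (ih fun j hj => h j (by simp [hj])) (chain_nonneg hp l)
      ((hp i).trans (h i (by simp)))
    have h2 : (1 - 1 / K) * K = K - 1 := by field_simp
    linarith

variable [DecidableEq ι]

/-- Least expected number of flips of coins of `S` until a tail is seen, or all of them have been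
flipped, when coin `i` shows heads with probability `p i`. -/
noncomputable def oracleCost (p : ι → ℝ) (S : Finset ι) : ℝ :=
  if h : S.Nonempty then
    1 + S.attach.inf' (by simpa using h) fun i => p i.1 * oracleCost p (S.erase i.1)
  else 0
termination_by S.card
decreasing_by exact Finset.card_erase_lt_of_mem i.2

@[simp]
theorem oracleCost_empty (p : ι → ℝ) : oracleCost p ∅ = 0 := by
  rw [oracleCost]; simp

theorem oracleCost_le {p : ι → ℝ} {S : Finset ι} {i : ι} (hi : i ∈ S) :
    oracleCost p S ≤ 1 + p i * oracleCost p (S.erase i) := by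
  rw [oracleCost, dif_pos ⟨i, hi⟩]
  gcongr
  exact Finset.inf'_le (fun i : S => p i.1 * oracleCost p (S.erase i.1))
    (Finset.mem_attach S ⟨i, hi⟩)

theorem exists_oracleCost_eq {p : ι → ℝ} {S : Finset ι} (hS : S.Nonempty) :
    ∃ i ∈ S, oracleCost p S = 1 + p i * oracleCost p (S.erase i) := by
  obtain ⟨i, -, hi⟩ := Finset.exists_mem_eq_inf' (s := S.attach) (by simpa using hS)
    fun i => p i.1 * oracleCost p (S.erase i.1)
  refine ⟨i.1, i.2, ?_⟩
  rw [oracleCost, dif_pos hS, hi]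

theorem oracleCost_nonneg {p : ι → ℝ} (hp : ∀ i, 0 ≤ p i) (S : Finset ι) : 0 ≤ oracleCost p S := by
  induction S using Finset.strongInduction with
  | H S ih =>
    rcases S.eq_empty_or_nonempty with rfl | hS
    · simp
    · obtain ⟨i, hi, h⟩ := exists_oracleCost_eq (p := p) hS
      rw [h]
      have := mul_nonneg (hp i) (ih _ (Finset.erase_ssubset hi))
      linarith

theorem one_le_oracleCost {p : ι → ℝ} (hp : ∀ i, 0 ≤ p i) {S : Finset ι} (hS : S.Nonempty) :
    1 ≤ oracleCost p S := by
  obtain ⟨i, hi, h⟩ := exists_oracleCost_eq (p := p) hS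
  rw [h]
  have := mul_nonneg (hp i) (oracleCost_nonneg hp (S.erase i))
  linarith

/-- It is optimal to flip the coin with the least probability of heads first. -/
theorem oracleCost_eq_of_forall_le {p : ι → ℝ} (hp : ∀ i, 0 ≤ p i) {S : Finset ι} {c : ι}
    (hc : c ∈ S) (hmin : ∀ j ∈ S, p c ≤ p j) :
    oracleCost p S = 1 + p c * oracleCost p (S.erase c) := by
  induction S using Finset.strongInduction with
  | H S ih =>
    refine le_antisymm (oracleCost_le hc) ?_
    obtain ⟨i, hi, h⟩ := exists_oracleCost_eq (p := p) ⟨c, hc⟩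
    rw [h]
    by_cases hic : i = c
    · rw [hic]
    -- Exchange argument: after `i`, the coin `c` is optimal by induction, and swapping the two
    -- changes the cost by `p c - p i ≤ 0`.
    have h1 := ih _ (Finset.erase_ssubset hi) (Finset.mem_erase.2 ⟨Ne.symm hic, hc⟩)
      fun j hj => hmin j (Finset.mem_of_mem_erase hj)
    have h2 : oracleCost p (S.erase c) ≤ 1 + p i * oracleCost p ((S.erase c).erase i) :=
      oracleCost_le (Finset.mem_erase.2 ⟨hic, hi⟩)
    rw [Finset.erase_right_comm] at h2
    rw [h1]
    have h3 := mul_le_mul_of_nonneg_left h2 (hp c)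
    have h4 := hmin i hi
    linarith

/-- A coin of greatest heads probability may be left to the end, so both searches start with the
same coin until only `d` remains. Without maximality this fails: removing a coin that never shows
heads can raise the cost. -/
theorem oracleCost_erase_le {p : ι → ℝ} (hp : ∀ i, 0 ≤ p i) {S : Finset ι} {d : ι}
    (hd : d ∈ S) (hmax : ∀ j ∈ S, p j ≤ p d) : oracleCost p (S.erase d) ≤ oracleCost p S := by
  induction S using Finset.strongInduction with
  | H S ih =>
    rcases (S.erase d).eq_empty_or_nonempty with h0 | h0
    · rw [h0, oracleCost_empty]
      exact oracleCost_nonneg hp S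
    obtain ⟨c, hc, hmin⟩ := Finset.exists_min_image (S.erase d) p h0
    have hcS := Finset.mem_of_mem_erase hc
    rw [oracleCost_eq_of_forall_le hp hc hmin, oracleCost_eq_of_forall_le hp hcS
      fun j hj => if h : j = d then h ▸ hmax c hcS else hmin j (Finset.mem_erase.2 ⟨h, hj⟩),
      Finset.erase_right_comm]
    have := ih _ (Finset.erase_ssubset hcS)
      (Finset.mem_erase.2 ⟨(Finset.ne_of_mem_erase hc).symm, hd⟩)
      fun j hj => hmax j (Finset.mem_of_mem_erase hj)
    have := mul_le_mul_of_nonneg_left this (hp c)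
    linarith

theorem geom_sum_le_oracleCost {p : ι → ℝ} {a : ℝ} (ha : 0 ≤ a) {S : Finset ι}
    (h : ∀ i ∈ S, a ≤ p i) (hp : ∀ i, 0 ≤ p i) :
    ∑ k ∈ Finset.range S.card, a ^ k ≤ oracleCost p S := by
  induction S using Finset.strongInduction with
  | H S ih =>
    rcases S.eq_empty_or_nonempty with rfl | hS
    · simp
    obtain ⟨i, hi, he⟩ := exists_oracleCost_eq (p := p) hS
    have := ih _ (Finset.erase_ssubset hi) fun j hj => h j (Finset.mem_of_mem_erase hj)
    rw [he, ← Finset.card_erase_add_one hi, geom_sum_succ, add_comm]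
    have h1 := mul_le_mul (h i hi) this (Finset.sum_nonneg fun k _ => pow_nonneg ha k) (hp i)
    linarith

theorem exists_list_chain_eq (p : ι → ℝ) (S : Finset ι) :
    ∃ l : List ι, l.Nodup ∧ l.toFinset = S ∧ chain p l = oracleCost p S := by
  induction S using Finset.strongInduction with
  | H S ih =>
    rcases S.eq_empty_or_nonempty with rfl | hS
    · exact ⟨[], by simp, by simp, by simp [chain]⟩
    obtain ⟨i, hi, he⟩ := exists_oracleCost_eq (p := p) hS
    obtain ⟨l, hl, hlS, hc⟩ := ih _ (Finset.erase_ssubset hi)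
    have hil : i ∉ l := by rw [← List.mem_toFinset, hlS]; simp
    exact ⟨i :: l, by simp [hl, hil], by simp [hlS, Finset.insert_erase hi],
      by rw [he, ← hc, chain]⟩

/-- From a state where the first side is the heavier one, the greedy order flips the coin that is
best for this side. -/
theorem greedy_step {p q : ι → ℝ} (hp : ∀ i, 0 ≤ p i) (hq : ∀ i, 0 ≤ q i)
    (hpq : ∀ i, p i + q i = 1) {S : Finset ι}
    (ih : ∀ T ⊂ S, ∀ P Q r : ℝ, 0 ≤ P → 0 ≤ Q → 0 ≤ r → P * Q ≤ r ^ 2 →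
      ∃ l : List ι, l.Nodup ∧ l.toFinset = T ∧ P * chain p l + Q * chain q l ≤
        P * oracleCost p T + Q * oracleCost q T + 4 / 3 * r)
    {P Q r : ℝ} (hQ : 0 ≤ Q) (hr : 0 ≤ r) (hQP : Q ≤ P) (hPQ : P * Q ≤ r ^ 2) :
    ∃ l : List ι, l.Nodup ∧ l.toFinset = S ∧ P * chain p l + Q * chain q l ≤
        P * oracleCost p S + Q * oracleCost q S + 4 / 3 * r := by
  rcases S.eq_empty_or_nonempty with rfl | hS
  · exact ⟨[], by simp, by simp, by simp [chain, hr]⟩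
  obtain ⟨c, hc, hmin⟩ := Finset.exists_min_image S p hS
  have hP : 0 ≤ P := hQ.trans hQP
  have hc0 := hp c
  have hc1 := hq c
  have hQr : Q ≤ r := by
    refine (sq_le_sq₀ hQ hr).1 ?_
    nlinarith
  -- The new weights have geometric mean at most `r * √(p c * q c)`, and `√(p c * q c) ≤ p c + q c /
  -- 4` by AM-GM.
  obtain ⟨l, hl, hlS, h⟩ := ih _ (Finset.erase_ssubset hc) (P * p c) (Q * q c)
    (r * (p c + q c / 4)) (by positivity) (by positivity) (by positivity) (by
      have h1 : 0 ≤ p c * q c := by positivity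
      have h2 : p c * q c ≤ (p c + q c / 4) ^ 2 := by nlinarith [sq_nonneg (p c - q c / 4)]
      calc P * p c * (Q * q c) = P * Q * (p c * q c) := by ring
        _ ≤ r ^ 2 * (p c + q c / 4) ^ 2 := mul_le_mul hPQ h2 h1 (sq_nonneg r)
        _ = _ := by ring)
  have hil : c ∉ l := by rw [← List.mem_toFinset, hlS]; simp
  refine ⟨c :: l, by simp [hl, hil], by simp [hlS, Finset.insert_erase hc], ?_⟩
  rw [oracleCost_eq_of_forall_le hp hc hmin]
  simp only [chain]
  have hp' : p c = 1 - q c := by linarith [hpq c]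
  rcases (S.erase c).eq_empty_or_nonempty with h0 | h0
  · rw [h0, oracleCost_empty, oracleCost_empty] at h
    rw [h0, oracleCost_empty]
    have h1 := mul_le_mul_of_nonneg_left (one_le_oracleCost hq hS) hQ
    have h2 : r * (p c + q c / 4) ≤ r * 1 := by
      apply mul_le_mul_of_nonneg_left _ hr
      linarith
    linarith
  -- The first side loses nothing at this step and the second at most `Q * q c ≤ r * q c`. The
  -- constant `4 / 3` solves `q c + 4 / 3 * (p c + q c / 4) = 4 / 3`.
  · have h1 : oracleCost q (S.erase c) ≤ oracleCost q S := by
      refine oracleCost_erase_le hq hc fun j hj => ?_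
      linarith [hmin j hj, hpq c, hpq j]
    have h2 := one_le_oracleCost hq h0
    have h3 := mul_le_mul_of_nonneg_left h1 hQ
    have h4 := mul_le_mul_of_nonneg_left h2 (mul_nonneg hQ hc0)
    have h5 := mul_le_mul_of_nonneg_right hQr hc1
    rw [hp'] at h h4 ⊢
    linarith

/-- The greedy order exceeds the oracle cost by at most `4 / 3` of the geometric mean of the two
weights. -/
theorem exists_list_greedy {p q : ι → ℝ} (hp : ∀ i, 0 ≤ p i) (hq : ∀ i, 0 ≤ q i)
    (hpq : ∀ i, p i + q i = 1) (S : Finset ι) {P Q r : ℝ} (hP : 0 ≤ P) (hQ : 0 ≤ Q) (hr : 0 ≤ r)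
    (hPQ : P * Q ≤ r ^ 2) :
    ∃ l : List ι, l.Nodup ∧ l.toFinset = S ∧ P * chain p l + Q * chain q l ≤
      P * oracleCost p S + Q * oracleCost q S + 4 / 3 * r := by
  induction S using Finset.strongInduction generalizing P Q r with
  | H S ih =>
    rcases le_total Q P with h | h
    · exact greedy_step hp hq hpq (fun T hT P Q r hP hQ hr hPQ => ih T hT hP hQ hr hPQ)
        hQ hr h hPQ
    · obtain ⟨l, h1, h2, h3⟩ := greedy_step hq hp (fun i => by rw [add_comm, hpq i])
        (fun T hT P Q r hP hQ hr hPQ => by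
          obtain ⟨l, h1, h2, h3⟩ := ih T hT hQ hP hr (by rwa [mul_comm])
          exact ⟨l, h1, h2, by linarith⟩) hP hr h (by rwa [mul_comm])
      exact ⟨l, h1, h2, by linarith⟩

end Oracle

/-! ### Expectation over independent coins. -/

theorem sum_outcome_prod {n : ℕ} (h : Fin n → Bool → ℝ) :
    ∑ ω : Outcome n, ∏ i, h i (ω i) = ∏ i, (h i true + h i false) := by
  have := Finset.prod_univ_sum (fun _ : Fin n => (Finset.univ : Finset Bool)) h
  simp only [Fintype.sum_bool, Fintype.piFinset_univ] at this
  exact this.symm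

/-- Expectation of a real-valued function of the outcome. -/
noncomputable def mean {n : ℕ} (p : Fin n → unitInterval) (X : Outcome n → ℝ) : ℝ :=
  ∑ ω, outcomeProb p ω * X ω

theorem expect_eq_mean {n : ℕ} (p : Fin n → unitInterval) (X : Outcome n → ℕ) :
    expect p X = mean p fun ω => (X ω : ℝ) := rfl

theorem mean_add {n : ℕ} (p : Fin n → unitInterval) (X Y : Outcome n → ℝ) :
    mean p (fun ω => X ω + Y ω) = mean p X + mean p Y := by
  simp only [mean, mul_add, Finset.sum_add_distrib]

theorem mean_const {n : ℕ} (p : Fin n → unitInterval) (c : ℝ) : mean p (fun _ => c) = c := by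
  have := sum_outcome_prod fun i b => if b then (p i : ℝ) else 1 - (p i : ℝ)
  simp only [mean, ← Finset.sum_mul, outcomeProb, this]
  simp

/-- The outcome of coin `i` is independent of a function of the outcomes of the other coins. -/
theorem mean_mul_of_update {n : ℕ} (p : Fin n → unitInterval) (i : Fin n) (g : Bool → ℝ)
    {X : Outcome n → ℝ} (hX : ∀ ω b, X (Function.update ω i b) = X ω) :
    mean p (fun ω => g (ω i) * X ω)
      = ((p i : ℝ) * g true + (1 - (p i : ℝ)) * g false) * mean p X := by
  set e := Equiv.funSplitAt i Bool with he
  have hupd : ∀ b r, e.symm (b, r) = Function.update (e.symm (true, r)) i b := by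
    intro b r
    ext j
    by_cases hj : j = i
    · subst hj; simp [he, Equiv.funSplitAt]
    · simp [he, Equiv.funSplitAt, hj]
  have hXe : ∀ b r, X (e.symm (b, r)) = X (e.symm (true, r)) := fun b r => by
    rw [hupd, hX]
  have hi : ∀ b r, e.symm (b, r) i = b := fun b r => by simp [he, Equiv.funSplitAt]
  have hprob : ∀ b r, outcomeProb p (e.symm (b, r)) = (if b then (p i : ℝ) else 1 - (p i : ℝ)) *
      ∏ j : {j // j ≠ i}, if r j then (p j : ℝ) else 1 - (p j : ℝ) := by
    intro b r
    rw [outcomeProb, Fintype.prod_eq_mul_prod_subtype_ne _ i, hi]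
    congr 1
    refine Finset.prod_congr rfl fun j _ => ?_
    have : e.symm (b, r) j = r j := by simp [he, Equiv.funSplitAt, j.2]
    rw [this]
  simp only [mean]
  rw [← Equiv.sum_comp e.symm, ← Equiv.sum_comp e.symm (fun ω => outcomeProb p ω * X ω),
    Fintype.sum_prod_type, Fintype.sum_prod_type]
  simp only [Fintype.sum_bool, hprob, hi, hXe false, ← Finset.sum_add_distrib, Finset.mul_sum]
  refine Finset.sum_congr rfl fun r _ => ?_
  simp only [if_true, Bool.false_eq_true, if_false]
  ring

/-! ### Recursion for the expected flips of a strategy. -/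

namespace Strategy

variable {n : ℕ}

theorem flips_congr {ω ω' : Outcome n} {S : Finset (Fin n)} (s : Strategy S)
    (h : ∀ i ∈ S, ω i = ω' i) (x y : Bool) : s.flips ω x y = s.flips ω' x y := by
  induction s generalizing x y with
  | done => rfl
  | flip i hi sH sT ihH ihT =>
    simp only [flips]
    rw [h i hi, ihH fun j hj => h j (Finset.mem_of_mem_erase hj),
      ihT fun j hj => h j (Finset.mem_of_mem_erase hj)]

theorem flips_update {S : Finset (Fin n)} {i : Fin n} (s : Strategy (S.erase i)) (ω : Outcome n)
    (b x y : Bool) : s.flips (Function.update ω i b) x y = s.flips ω x y :=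
  s.flips_congr (fun _ hj => Function.update_of_ne (Finset.ne_of_mem_erase hj) _ _) x y

@[simp]
theorem flips_true_true (ω : Outcome n) {S : Finset (Fin n)} (s : Strategy S) :
    s.flips ω true true = 0 := by
  cases s <;> simp [flips]

/-- Expected number of further flips of a strategy. -/
noncomputable def meanFlips (p : Fin n → unitInterval) {S : Finset (Fin n)} (s : Strategy S)
    (x y : Bool) : ℝ :=
  mean p fun ω => (s.flips ω x y : ℝ)

theorem meanFlips_flip (p : Fin n → unitInterval) {S : Finset (Fin n)} {i : Fin n} (hi : i ∈ S)
    (sH sT : Strategy (S.erase i)) {x y : Bool} (hxy : (x && y) = false) :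
    (flip i hi sH sT).meanFlips p x y
      = 1 + ((p i : ℝ) * sH.meanFlips p true y + (1 - (p i : ℝ)) * sT.meanFlips p x true) := by
  have hH := mean_mul_of_update p i (fun b => if b then 1 else 0)
    (X := fun ω => (sH.flips ω true y : ℝ)) fun ω b => by rw [sH.flips_update]
  have hT := mean_mul_of_update p i (fun b => if b then 0 else 1)
    (X := fun ω => (sT.flips ω x true : ℝ)) fun ω b => by rw [sT.flips_update]
  simp only [if_true, Bool.false_eq_true, if_false, mul_one, mul_zero, add_zero, zero_add] at hH hT
  simp only [meanFlips]
  rw [← hH, ← hT, ← mean_add, ← mean_const p 1, ← mean_add, mean_const]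
  congr 1
  ext ω
  simp only [flips, hxy]
  cases ω i <;> simp

@[simp]
theorem meanFlips_true_true (p : Fin n → unitInterval) {S : Finset (Fin n)} (s : Strategy S) :
    s.meanFlips p true true = 0 := by
  simp [meanFlips, mean_const]

@[simp]
theorem meanFlips_done (p : Fin n → unitInterval) {S : Finset (Fin n)} (hS : S = ∅) (x y : Bool) :
    (done hS).meanFlips p x y = 0 := by
  simp [meanFlips, flips, mean_const]

end Strategy

/-! ### The optimal adaptive cost through the first coin. -/

section Adaptive

variable {n : ℕ} (p : Fin n → unitInterval)

/-- Probability of heads as a real number. -/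
def headProb (i : Fin n) : ℝ := p i

/-- Probability of tails as a real number. -/
def tailProb (i : Fin n) : ℝ := 1 - p i

theorem headProb_nonneg (i : Fin n) : 0 ≤ headProb p i := (p i).2.1

theorem tailProb_nonneg (i : Fin n) : 0 ≤ tailProb p i := sub_nonneg.2 (p i).2.2

theorem headProb_add_tailProb (i : Fin n) : headProb p i + tailProb p i = 1 := by
  simp [headProb, tailProb]

theorem headProb_le_one (i : Fin n) : headProb p i ≤ 1 := (p i).2.2

theorem tailProb_le_one (i : Fin n) : tailProb p i ≤ 1 := by
  linarith [headProb_add_tailProb p i, headProb_nonneg p i]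

/-- Once a head has been seen, the tails branch costs nothing, so a strategy amounts to an order
along its heads branches. -/
theorem oracleCost_headProb_le_meanFlips {S : Finset (Fin n)} (s : Strategy S) :
    oracleCost (headProb p) S ≤ s.meanFlips p true false := by
  induction s with
  | done hS => simp [hS]
  | flip i hi sH sT ihH ihT =>
    rw [Strategy.meanFlips_flip p hi sH sT rfl, Strategy.meanFlips_true_true, mul_zero, add_zero]
    have := mul_le_mul_of_nonneg_left ihH (headProb_nonneg p i)
    exact (oracleCost_le hi).trans (by simp only [headProb] at *; linarith)

theorem oracleCost_tailProb_le_meanFlips {S : Finset (Fin n)} (s : Strategy S) :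
    oracleCost (tailProb p) S ≤ s.meanFlips p false true := by
  induction s with
  | done hS => simp [hS]
  | flip i hi sH sT ihH ihT =>
    rw [Strategy.meanFlips_flip p hi sH sT rfl, Strategy.meanFlips_true_true, mul_zero, zero_add]
    have := mul_le_mul_of_nonneg_left ihT (tailProb_nonneg p i)
    exact (oracleCost_le hi).trans (by simp only [tailProb] at *; linarith)

theorem exists_meanFlips_headProb_eq (S : Finset (Fin n)) :
    ∃ s : Strategy S, s.meanFlips p true false = oracleCost (headProb p) S := by
  induction S using Finset.strongInduction with
  | H S ih =>
    rcases S.eq_empty_or_nonempty with rfl | hS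
    · exact ⟨.done rfl, by simp⟩
    obtain ⟨i, hi, he⟩ := exists_oracleCost_eq (p := headProb p) hS
    obtain ⟨s, hs⟩ := ih _ (Finset.erase_ssubset hi)
    refine ⟨.flip i hi s s, ?_⟩
    rw [Strategy.meanFlips_flip p hi s s rfl, hs, he]
    simp [headProb]

theorem exists_meanFlips_tailProb_eq (S : Finset (Fin n)) :
    ∃ s : Strategy S, s.meanFlips p false true = oracleCost (tailProb p) S := by
  induction S using Finset.strongInduction with
  | H S ih =>
    rcases S.eq_empty_or_nonempty with rfl | hS
    · exact ⟨.done rfl, by simp⟩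
    obtain ⟨i, hi, he⟩ := exists_oracleCost_eq (p := tailProb p) hS
    obtain ⟨s, hs⟩ := ih _ (Finset.erase_ssubset hi)
    refine ⟨.flip i hi s s, ?_⟩
    rw [Strategy.meanFlips_flip p hi s s rfl, hs, he]
    simp [tailProb]

/-- Cost of the best adaptive strategy that flips coin `i` first. -/
noncomputable def firstCost (i : Fin n) : ℝ :=
  1 + (headProb p i * oracleCost (headProb p) (Finset.univ.erase i)
    + tailProb p i * oracleCost (tailProb p) (Finset.univ.erase i))

theorem exists_firstCost_le_strategyCost (hn : 1 ≤ n)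
    (s : Strategy (Finset.univ : Finset (Fin n))) :
    ∃ i, firstCost p i ≤ strategyCost p s := by
  cases s with
  | done hS => exact absurd (hS ▸ Finset.mem_univ (⟨0, hn⟩ : Fin n)) (Finset.notMem_empty _)
  | flip i hi sH sT =>
    refine ⟨i, ?_⟩
    change _ ≤ (Strategy.flip i hi sH sT).meanFlips p false false
    rw [Strategy.meanFlips_flip p hi sH sT rfl, firstCost]
    have h1 := mul_le_mul_of_nonneg_left (oracleCost_headProb_le_meanFlips p sH)
      (headProb_nonneg p i)
    have h2 := mul_le_mul_of_nonneg_left (oracleCost_tailProb_le_meanFlips p sT)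
      (tailProb_nonneg p i)
    simp only [headProb, tailProb] at *
    linarith

theorem exists_strategyCost_eq_firstCost (i : Fin n) :
    ∃ s : Strategy (Finset.univ : Finset (Fin n)), strategyCost p s = firstCost p i := by
  obtain ⟨sH, hH⟩ := exists_meanFlips_headProb_eq p (Finset.univ.erase i)
  obtain ⟨sT, hT⟩ := exists_meanFlips_tailProb_eq p (Finset.univ.erase i)
  refine ⟨.flip i (Finset.mem_univ i) sH sT, ?_⟩
  change (Strategy.flip i _ sH sT).meanFlips p false false = _
  rw [Strategy.meanFlips_flip p _ sH sT rfl, hH, hT]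
  rfl

theorem optAdaptive_le_firstCost (i : Fin n) : optAdaptive p ≤ firstCost p i := by
  obtain ⟨s, hs⟩ := exists_strategyCost_eq_firstCost p i
  exact hs ▸ ciInf_le ⟨0, by rintro _ ⟨s, rfl⟩; exact expect_nonneg p _⟩ s

theorem le_optAdaptive (hn : 1 ≤ n) {c : ℝ} (h : ∀ i, c ≤ firstCost p i) : c ≤ optAdaptive p := by
  have := Strategy.nonempty (Finset.univ : Finset (Fin n))
  refine le_ciInf fun s => ?_
  obtain ⟨i, hi⟩ := exists_firstCost_le_strategyCost p hn s
  exact (h i).trans hi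

theorem one_le_optAdaptive (hn : 1 ≤ n) : 1 ≤ optAdaptive p := by
  refine le_optAdaptive p hn fun i => ?_
  have h1 := mul_nonneg (headProb_nonneg p i)
    (oracleCost_nonneg (headProb_nonneg p) (Finset.univ.erase i))
  have h2 := mul_nonneg (tailProb_nonneg p i)
    (oracleCost_nonneg (tailProb_nonneg p) (Finset.univ.erase i))
  rw [firstCost]
  linarith

end Adaptive

/-! ### The cost of an ordering as two one-sided searches. -/

section Nonadaptive

variable {n : ℕ} (p : Fin n → unitInterval)

theorem sum_ofFn_eq_chain {ι : Type*} (f : ι → ℝ) {m : ℕ} (a : Fin m → ι) :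
    ∑ j : Fin m, ∏ i : Fin m, (if i < j then f (a i) else 1) = chain f (List.ofFn a) := by
  induction m with
  | zero => simp [chain]
  | succ m ih =>
    rw [Fin.sum_univ_succ, List.ofFn_succ]
    simp only [Fin.prod_univ_succ, chain, ← ih (fun i => a i.succ), Fin.not_lt_zero, if_false,
      Fin.succ_pos, if_true, Fin.succ_lt_succ_iff, Finset.mul_sum]
    simp

theorem mean_prod (g : Fin n → Bool → ℝ) :
    mean p (fun ω => ∏ i, g i (ω i))
      = ∏ i, (headProb p i * g i true + tailProb p i * g i false) := by
  have := sum_outcome_prod fun i b => (if b then (p i : ℝ) else 1 - (p i : ℝ)) * g i b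
  simp only [Finset.prod_mul_distrib, if_true, Bool.false_eq_true, if_false] at this
  exact this

theorem prod_ite_eq_ite {ω : Outcome n} {a : Equiv.Perm (Fin n)} (j : Fin n) (b : Bool) :
    ∏ i, (if a.symm i < j then (if ω i = b then 1 else 0) else 1 : ℝ)
      = if ∀ i < j, ω (a i) = b then 1 else 0 := by
  split_ifs with h
  · refine Finset.prod_eq_one fun i _ => ?_
    split_ifs with h1 h2
    · rfl
    · exact absurd (by simpa using h _ h1) h2
    · rfl
  · push Not at h
    obtain ⟨i, hi, hb⟩ := h
    exact Finset.prod_eq_zero (Finset.mem_univ (a i)) (by simp [hi, hb])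

/-- A position is reached when the earlier coins are all heads or all tails. These cases exclude
each other except at position `0`, where both hold vacuously; hence the correction. -/
theorem orderingFlips_eq_sum (hn : 1 ≤ n) (a : Equiv.Perm (Fin n)) (ω : Outcome n) :
    (orderingFlips a ω : ℝ) = ∑ j : Fin n,
      ((∏ i, (if a.symm i < j then (if ω i = true then 1 else 0) else 1 : ℝ))
        + (∏ i, (if a.symm i < j then (if ω i = false then 1 else 0) else 1 : ℝ))
        - if j = ⟨0, hn⟩ then 1 else 0) := by
  rw [orderingFlips, Finset.card_filter, Nat.cast_sum]
  refine Finset.sum_congr rfl fun j _ => ?_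
  rw [prod_ite_eq_ite, prod_ite_eq_ite]
  by_cases hj : j = ⟨0, hn⟩
  · simp [Reaches, hj, Fin.lt_def]
  · have hj0 : (⟨0, hn⟩ : Fin n) < j := by
      rw [Fin.lt_def]
      exact Nat.pos_of_ne_zero fun h => hj (Fin.ext h)
    by_cases hH : ∀ i < j, ω (a i) = true
    · have hT : ¬ ∀ i < j, ω (a i) = false := fun h => by
        simpa [hH _ hj0] using h _ hj0
      have hR : Reaches a ω j := fun ⟨_, i, hi, h⟩ => by simp [hH i hi] at h
      simp only [if_pos hH, if_neg hT, if_pos hR, if_neg hj]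
      norm_num
    · by_cases hT : ∀ i < j, ω (a i) = false
      · have hR : Reaches a ω j := fun ⟨⟨i, hi, h⟩, _⟩ => by simp [hT i hi] at h
        simp only [if_neg hH, if_pos hT, if_pos hR, if_neg hj]
        norm_num
      · have hR : ¬ Reaches a ω j := by
          simp only [Reaches, not_not]
          push Not at hH hT
          simpa using And.intro hT hH
        simp only [if_neg hH, if_neg hT, if_neg hR, if_neg hj]
        norm_num

theorem orderingCost_eq_chain (hn : 1 ≤ n) (a : Equiv.Perm (Fin n)) :
    orderingCost p a
      = chain (headProb p) (List.ofFn a) + chain (tailProb p) (List.ofFn a) - 1 := by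
  have hmean : ∀ (j : Fin n) (b : Bool),
      mean p (fun ω => ∏ i, (if a.symm i < j then (if ω i = b then 1 else 0) else 1 : ℝ))
        = ∏ i, if i < j then (if b then headProb p (a i) else tailProb p (a i)) else 1 := by
    intro j b
    rw [mean_prod p fun i c => if a.symm i < j then (if c = b then 1 else 0) else 1,
      ← Equiv.prod_comp a]
    refine Finset.prod_congr rfl fun i _ => ?_
    rw [Equiv.symm_apply_apply]
    by_cases h : i < j <;> cases b <;> simp [h, headProb_add_tailProb]
  have hT := fun j => hmean j true
  have hF := fun j => hmean j false
  simp only [if_true, Bool.false_eq_true, if_false, mean] at hT hF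
  rw [orderingCost, expect_eq_mean, mean]
  simp only [orderingFlips_eq_sum hn, Finset.mul_sum]
  rw [Finset.sum_comm, ← sum_ofFn_eq_chain, ← sum_ofFn_eq_chain, ← Finset.sum_add_distrib]
  simp only [mul_sub, mul_add, Finset.sum_sub_distrib, Finset.sum_add_distrib, hT, hF]
  have h1 : ∀ j : Fin n, ∑ ω, outcomeProb p ω * (if j = ⟨0, hn⟩ then (1 : ℝ) else 0)
      = if j = ⟨0, hn⟩ then 1 else 0 := fun j => mean_const p _
  simp only [h1, Finset.sum_ite_eq', Finset.mem_univ, if_true]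

theorem exists_perm_of_list {l : List (Fin n)} (hl : l.Nodup) (hS : l.toFinset = Finset.univ) :
    ∃ a : Equiv.Perm (Fin n), List.ofFn a = l := by
  have hlen : l.length = n := by
    rw [← List.toFinset_card_of_nodup hl, hS, Finset.card_univ, Fintype.card_fin]
  have hinj : Function.Injective (l.get ∘ Fin.cast hlen.symm) :=
    (List.nodup_iff_injective_get.1 hl).comp (Fin.cast_injective _)
  refine ⟨Equiv.ofBijective _ (Finite.injective_iff_bijective.1 hinj), ?_⟩
  exact List.ext_getElem (by simp [hlen]) fun i h1 h2 => by simp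

theorem optNonadaptive_le_chain (hn : 1 ≤ n) {l : List (Fin n)} (hl : l.Nodup)
    (hS : l.toFinset = Finset.univ) :
    optNonadaptive p ≤ chain (headProb p) l + chain (tailProb p) l - 1 := by
  obtain ⟨a, rfl⟩ := exists_perm_of_list hl hS
  rw [← orderingCost_eq_chain p hn a]
  exact ciInf_le (Set.finite_range _).bddBelow a

end Nonadaptive

/-! ### Affine lower bounds for truncated geometric series. -/

theorem four_mul_le_geom_sum {a : ℝ} (ha : 0 ≤ a) (ha2 : a ≤ 1 / 2) (m : ℕ) :
    4 * a ≤ ∑ k ∈ Finset.range m, a ^ k + 2 / 2 ^ m := by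
  induction m with
  | zero => simp; linarith
  | succ m ih =>
    rw [geom_sum_succ, pow_succ, ← div_div]
    have h1 := mul_le_mul_of_nonneg_left ih ha
    have h2 : (0 : ℝ) ≤ 2 / 2 ^ m := by positivity
    have h3 := mul_le_mul_of_nonneg_right ha2 h2
    nlinarith [sq_nonneg (1 - 2 * a)]

theorem two_le_geom_sum {a : ℝ} (ha : 1 / 2 ≤ a) (m : ℕ) :
    2 ≤ ∑ k ∈ Finset.range m, a ^ k + 2 / 2 ^ m := by
  induction m with
  | zero => simp
  | succ m ih =>
    rw [geom_sum_succ, pow_succ, ← div_div]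
    have h : (0 : ℝ) ≤ ∑ k ∈ Finset.range m, a ^ k :=
      Finset.sum_nonneg fun k _ => pow_nonneg (by linarith) k
    have := mul_le_mul_of_nonneg_right ha h
    linarith

/-- The last terms are estimated by `two_le_geom_sum`, leaving `1 + a + 2 * a ^ 2`, whose tangent at
`1 / 2` is `3 * a + 1 / 2`. -/
theorem three_mul_add_half_le_geom_sum {a : ℝ} (ha : 1 / 2 ≤ a) (ha1 : a ≤ 1) {m : ℕ}
    (hm : 2 ≤ m) : 3 * a + 1 / 2 ≤ ∑ k ∈ Finset.range m, a ^ k + 8 / 2 ^ m := by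
  obtain ⟨m, rfl⟩ := Nat.exists_eq_add_of_le' hm
  have h := two_le_geom_sum ha m
  rw [geom_sum_succ, geom_sum_succ, pow_add]
  have he : (8 : ℝ) / (2 ^ m * 2 ^ 2) = 2 / 2 ^ m := by field_simp; norm_num
  rw [he]
  have h0 : (0 : ℝ) ≤ 2 / 2 ^ m := by positivity
  have h1 := mul_le_mul_of_nonneg_left h (sq_nonneg a)
  have h2 : a ^ 2 * (2 / 2 ^ m) ≤ 1 * (2 / 2 ^ m) :=
    mul_le_mul_of_nonneg_right (by nlinarith) h0
  nlinarith [sq_nonneg (2 * a - 1)]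

theorem quadratic_le_geom_sum {a : ℝ} (ha : 0 ≤ a) {m : ℕ} (hm : 3 ≤ m) :
    1 + a + a ^ 2 ≤ ∑ k ∈ Finset.range m, a ^ k := by
  have := Finset.sum_le_sum_of_subset_of_nonneg (f := fun k => a ^ k)
    (Finset.range_subset_range.2 hm) fun k _ _ => pow_nonneg ha k
  simpa [Finset.sum_range_succ] using this

/-- The upper bound for an instance whose first coin shows heads with probability `x` and whose two
extreme other coins show heads with probabilities `a` and `1 - b`, with the rest `T` in between;
`M` is the least agreement probability of two of these three coins. -/
theorem nonadaptive_le_of_forall_list {ι : Type*} [DecidableEq ι] {p q : ι → ℝ}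
    (hp : ∀ i, 0 ≤ p i) (hq : ∀ i, 0 ≤ q i) (hpq : ∀ i, p i + q i = 1) {T : Finset ι}
    (hT : 3 ≤ T.card) {a b x M N : ℝ} (ha : 0 ≤ a) (hab : a ≤ b) (hab1 : a + b ≤ 1)
    (hx : 0 ≤ x) (hx1 : x ≤ 1) (hTa : ∀ i ∈ T, a ≤ p i) (hTb : ∀ i ∈ T, b ≤ q i)
    (hm1 : M ≤ x * a + (1 - x) * (1 - a)) (hm2 : M ≤ x * (1 - b) + (1 - x) * b)
    (hm3 : M ≤ a * (1 - b) + b * (1 - a))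
    (hN : ∀ l : List ι, l.Nodup → l.toFinset = T →
      N ≤ 2 + M + (x * a * (1 - b)) * chain p l + ((1 - x) * b * (1 - a)) * chain q l) :
    N ≤ 6 / 5 * (2 + x * a * oracleCost p T + (1 - x) * b * oracleCost q T)
      + 2 * (8 / 2 ^ T.card) := by
  have hb : 0 ≤ b := ha.trans hab
  have hx' : 0 ≤ 1 - x := by linarith
  have ha' : 0 ≤ 1 - a := by linarith
  have hb' : 0 ≤ 1 - b := by linarith
  have hu := geom_sum_le_oracleCost ha hTa hp
  have hv := geom_sum_le_oracleCost hb hTb hq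
  have hP : 0 ≤ x * a * (1 - b) := by positivity
  have hQ : 0 ≤ (1 - x) * b * (1 - a) := by positivity
  refine nonadaptive_le_of_le ha hab hab1 hx hx1 (by positivity)
    ((quadratic_le_geom_sum ha hT).trans hu) ((quadratic_le_geom_sum hb hT).trans hv)
    (fun h => ?_) (fun h => ?_) hm1 hm2 hm3 ?_ fun K hK hbK => ?_
  · have h1 := four_mul_le_geom_sum hb h T.card
    have h2 : (2 : ℝ) / 2 ^ T.card ≤ 8 / 2 ^ T.card := by gcongr; norm_num
    linarith
  · have h1 := three_mul_add_half_le_geom_sum h (by linarith) (by omega : 2 ≤ T.card)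
    linarith
  · set P := x * a * (1 - b)
    set Q := (1 - x) * b * (1 - a)
    -- Weighted AM-GM makes the greedy loss affine in `x`: `4 / 3 * r = P + 4 / 9 * Q`.
    obtain ⟨l, hl, hlT, h⟩ := exists_list_greedy hp hq hpq T hP hQ
      (r := 3 / 4 * P + 1 / 3 * Q) (by positivity)
      (by nlinarith [sq_nonneg (3 / 4 * P - 1 / 3 * Q)])
    have := hN l hl hlT
    linarith
  · obtain ⟨l, hl, hlT, h⟩ := exists_list_chain_eq q T
    have h1 := hN l hl hlT
    have h2 : chain p l ≤ K := by
      refine chain_le_of_forall_le hK (fun i hi => ?_) hp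
      have := hTb i (by rw [← hlT]; simpa using hi)
      linarith [hpq i]
    have h3 := mul_le_mul_of_nonneg_left h2 hP
    rw [← h]
    linarith

/-! ### The upper bound. -/

section Upper

variable {n : ℕ} (p : Fin n → unitInterval)

theorem optNonadaptive_le_firstCost (hn : 6 ≤ n) (x : Fin n) :
    optNonadaptive p ≤ 6 / 5 * firstCost p x + 128 / 2 ^ n := by
  have hhp := headProb_nonneg p
  have htp := tailProb_nonneg p
  have hht := headProb_add_tailProb p
  set S := (Finset.univ : Finset (Fin n)).erase x with hSdef
  have hScard : S.card = n - 1 := by simp [hSdef]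
  obtain ⟨c, hc, hcmin⟩ := S.exists_min_image (headProb p) (Finset.card_pos.1 (by omega))
  have hSccard : (S.erase c).card = n - 2 := by rw [Finset.card_erase_of_mem hc]; omega
  obtain ⟨d, hd, hdmax⟩ := (S.erase c).exists_max_image (headProb p)
    (Finset.card_pos.1 (by omega))
  have hdS := Finset.mem_of_mem_erase hd
  have hdc : d ≠ c := Finset.ne_of_mem_erase hd
  set T := (S.erase c).erase d with hTdef
  have hTcard : T.card = n - 3 := by rw [Finset.card_erase_of_mem hd]; omega
  have hdmax' : ∀ j ∈ S, headProb p j ≤ headProb p d := fun j hj =>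
    if h : j = c then h ▸ hcmin d hdS else hdmax j (Finset.mem_erase.2 ⟨h, hj⟩)
  have hcd := hcmin d hdS
  have hTS : ∀ i ∈ T, i ∈ S := fun i hi =>
    Finset.mem_of_mem_erase (Finset.mem_of_mem_erase hi)
  have hA : oracleCost (headProb p) S
      = 1 + headProb p c * oracleCost (headProb p) (S.erase c) :=
    oracleCost_eq_of_forall_le hhp hc hcmin
  have hA' : oracleCost (headProb p) T ≤ oracleCost (headProb p) (S.erase c) :=
    oracleCost_erase_le hhp hd hdmax
  have hB : oracleCost (tailProb p) S
      = 1 + tailProb p d * oracleCost (tailProb p) (S.erase d) :=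
    oracleCost_eq_of_forall_le htp hdS fun j hj => by
      linarith [hdmax' j hj, hht j, hht d]
  have hB' : oracleCost (tailProb p) T ≤ oracleCost (tailProb p) (S.erase d) := by
    rw [hTdef, Finset.erase_right_comm]
    refine oracleCost_erase_le htp (Finset.mem_erase.2 ⟨hdc.symm, hc⟩) fun j hj => ?_
    linarith [hcmin j (Finset.mem_of_mem_erase hj), hht j, hht c]
  have hfirst : 2 + headProb p x * headProb p c * oracleCost (headProb p) T
      + tailProb p x * tailProb p d * oracleCost (tailProb p) T ≤ firstCost p x := by
    rw [firstCost, hA, hB]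
    have h1 := mul_le_mul_of_nonneg_left hA' (mul_nonneg (hhp x) (hhp c))
    have h2 := mul_le_mul_of_nonneg_left hB' (mul_nonneg (htp x) (htp d))
    linarith [hht x]
  have hTx : x ∉ T := fun h => by simpa [hSdef] using hTS x h
  have hTc : c ∉ T := by simp [hTdef]
  have hTd : d ∉ T := by simp [hTdef]
  have hxc : x ≠ c := fun h => by simp [hSdef, ← h] at hc
  have hxd : x ≠ d := fun h => by simp [hSdef, ← h] at hdS
  have huniv : insert x (insert c (insert d T)) = Finset.univ := by
    rw [hTdef, Finset.insert_erase hd, Finset.insert_erase hc, hSdef,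
      Finset.insert_erase (Finset.mem_univ x)]
  set h := headProb p
  set t := tailProb p
  set M := min (min (h x * h c + t x * t c) (h x * h d + t x * t d)) (h c * h d + t c * t d)
    with hM
  have hlist : ∀ l : List (Fin n), l.Nodup → l.toFinset = T →
      optNonadaptive p ≤ 2 + M + (h x * h c * h d) * chain h l + (t x * t d * t c) * chain t l := by
    intro l hl hlT
    have hxl : x ∉ l := by rwa [← List.mem_toFinset, hlT]
    have hcl : c ∉ l := by rwa [← List.mem_toFinset, hlT]
    have hdl : d ∉ l := by rwa [← List.mem_toFinset, hlT]
    -- The three orders differ only in which pair comes first, and its agreement probability is the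
    -- chance of a third flip.
    have h1 := optNonadaptive_le_chain p (by omega) (l := x :: c :: d :: l)
      (by simp [*, hdc.symm]) (by simp [hlT, huniv])
    have h2 := optNonadaptive_le_chain p (by omega) (l := x :: d :: c :: l)
      (by simp [*]) (by rw [← huniv, ← hlT]; ext; simp; tauto)
    have h3 := optNonadaptive_le_chain p (by omega) (l := c :: d :: x :: l)
      (by simp [*, hdc.symm, hxc.symm, hxd.symm]) (by rw [← huniv, ← hlT]; ext; simp; tauto)
    simp only [chain] at h1 h2 h3
    have : optNonadaptive p - 2 - (h x * h c * h d) * chain h l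
        - (t x * t d * t c) * chain t l ≤ M := by
      refine le_min (le_min ?_ ?_) ?_
      · linarith [hht x]
      · linarith [hht x]
      · linarith [hht c]
    linarith
  have hx1 := headProb_le_one p x
  have hm1 : M ≤ h x * h c + t x * t c := (min_le_left _ _).trans (min_le_left _ _)
  have hm2 : M ≤ h x * h d + t x * t d := (min_le_left _ _).trans (min_le_right _ _)
  have hm3 : M ≤ h c * h d + t c * t d := min_le_right _ _
  have htx : t x = 1 - h x := by linarith [hht x]
  have htc : t c = 1 - h c := by linarith [hht c]
  have hhd : h d = 1 - t d := by linarith [hht d]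
  have hpow : (2 : ℝ) * (8 / 2 ^ T.card) = 128 / 2 ^ n := by
    obtain ⟨k, rfl⟩ := Nat.exists_eq_add_of_le' (by omega : 3 ≤ n)
    rw [hTcard, Nat.add_sub_cancel, pow_add]
    field_simp
    norm_num
  have hcT : ∀ i ∈ T, h c ≤ h i := fun i hi => hcmin i (hTS i hi)
  have hdT : ∀ i ∈ T, t d ≤ t i := fun i hi => by
    linarith [hdmax' i (hTS i hi), hht i, hht d]
  rw [htc, hhd] at hlist hm3
  rw [htc] at hm1
  rw [hhd] at hm2
  rw [← hpow]
  refine le_trans ?_ (add_le_add_left (mul_le_mul_of_nonneg_left hfirst (by norm_num)) _)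
  -- Exchanging heads and tails swaps the roles of `c` and `d`, so `a ≤ b` may be assumed.
  rcases le_total (h c) (t d) with hab | hab
  · rw [htx] at hm1 hm2 hlist ⊢
    exact nonadaptive_le_of_forall_list hhp htp hht (by omega) (hhp c) hab (by linarith)
      (hhp x) hx1 hcT hdT hm1 hm2 (by linarith) hlist
  · have hhx : h x = 1 - t x := by linarith
    rw [hhx] at hm1 hm2 hlist ⊢
    have := nonadaptive_le_of_forall_list htp hhp (fun i => by rw [add_comm]; exact hht i)
      (T := T) (N := optNonadaptive p) (M := M) (by omega) (htp d) hab (by linarith)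
      (htp x) (by linarith [hhp x]) hdT hcT (by linarith) (by linarith) (by linarith)
      fun l hl hlT => by have := hlist l hl hlT; linarith
    linarith

theorem optNonadaptive_le_two_mul (hn : 1 ≤ n) : optNonadaptive p ≤ 2 * n - 1 := by
  refine (optNonadaptive_le_chain p hn (List.nodup_finRange n)
    (by ext; simp)).trans ?_
  have h1 := chain_le_length (headProb_nonneg p) (headProb_le_one p) (List.finRange n)
  have h2 := chain_le_length (tailProb_nonneg p) (tailProb_le_one p) (List.finRange n)
  rw [List.length_finRange] at h1 h2
  linarith

theorem gapRatio_le (hn : 1 ≤ n) : gapRatio p ≤ 6 / 5 + 288 / 2 ^ n := by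
  have hAD := one_le_optAdaptive p hn
  rw [gapRatio, div_le_iff₀ (by linarith)]
  have hpos : (0 : ℝ) < 2 ^ n := by positivity
  rcases le_or_gt 6 n with h6 | h6
  · have h : (optNonadaptive p - 128 / 2 ^ n) * (5 / 6) ≤ optAdaptive p :=
      le_optAdaptive p hn fun x => by linarith [optNonadaptive_le_firstCost p h6 x]
    have h1 : (128 : ℝ) / 2 ^ n ≤ 288 / 2 ^ n := by gcongr; norm_num
    have h2 := mul_le_mul_of_nonneg_left hAD (by positivity : (0 : ℝ) ≤ 288 / 2 ^ n)
    linarith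
  · have h := optNonadaptive_le_two_mul p hn
    have hn5 : (n : ℝ) ≤ 5 := by exact_mod_cast (by omega : n ≤ 5)
    -- For `n ≤ 5` every optimal ordering costs at most `2 * 5 - 1 = 9`, and `288 = 9 * 2 ^ 5`.
    have h1 : (9 : ℝ) ≤ 288 / 2 ^ n := by
      rw [le_div_iff₀ hpos]
      have : (2 : ℝ) ^ n ≤ 2 ^ 5 := pow_le_pow_right₀ (by norm_num) (by omega)
      linarith
    have h2 := mul_le_mul_of_nonneg_left hAD (by linarith : (0 : ℝ) ≤ 288 / 2 ^ n)
    linarith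

end Upper

/-! ### The lower bound: one coin that always shows tails among fair coins. -/

section Lower

theorem headProb_oneTailsInstance {n : ℕ} (i : Fin n) :
    headProb (oneTailsInstance n) i = if i.val = 0 then 0 else 1 / 2 := by
  rw [headProb, oneTailsInstance]
  split_ifs <;> rfl

theorem tailProb_oneTailsInstance {n : ℕ} (i : Fin n) :
    tailProb (oneTailsInstance n) i = if i.val = 0 then 1 else 1 / 2 := by
  have h := headProb_add_tailProb (oneTailsInstance n) i
  rw [headProb_oneTailsInstance] at h
  split_ifs at h ⊢ <;> linarith

theorem chain_tailProb_oneTailsInstance {n : ℕ} {l : List (Fin n)} (hl : ∀ i ∈ l, i.val ≠ 0) :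
    chain (tailProb (oneTailsInstance n)) l = 2 - 2 / 2 ^ l.length := by
  induction l with
  | nil => simp [chain]
  | cons i l ih =>
    rw [chain, ih fun j hj => hl j (by simp [hj]), tailProb_oneTailsInstance,
      if_neg (hl i (by simp)),
      List.length_cons, pow_succ]
    field_simp
    ring

/-- Putting a fair coin in front sends the sum `s` to `2 + s / 2`, and the closed form obeys this
recursion wherever the special coin stands. All orderings therefore cost the same. -/
theorem chain_add_chain_oneTailsInstance {n : ℕ} {l : List (Fin n)} (hl : l.Nodup)
    {z : Fin n} (hz : z.val = 0) (hzl : z ∈ l) :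
    chain (headProb (oneTailsInstance n)) l + chain (tailProb (oneTailsInstance n)) l
      = 4 - 4 / 2 ^ l.length := by
  induction l with
  | nil => simp at hzl
  | cons i l ih =>
    rw [List.nodup_cons] at hl
    rw [chain, chain, headProb_oneTailsInstance, tailProb_oneTailsInstance, List.length_cons,
      pow_succ]
    by_cases hi : i.val = 0
    · have h0 : ∀ j ∈ l, j.val ≠ 0 := fun j hj h =>
        hl.1 ((Fin.ext (h.trans hi.symm) : j = i) ▸ hj)
      rw [if_pos hi, if_pos hi, chain_tailProb_oneTailsInstance h0]
      field_simp
      ring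
    · have hzi : z ≠ i := fun h => hi (h ▸ hz)
      have h := ih hl.2 ((List.mem_cons.1 hzl).resolve_left hzi)
      rw [if_neg hi, if_neg hi]
      have h2 : (4 : ℝ) / (2 ^ l.length * 2) = 4 / 2 ^ l.length / 2 := by rw [div_div]
      rw [h2]
      linarith

theorem orderingCost_oneTailsInstance {n : ℕ} (hn : 1 ≤ n) (a : Equiv.Perm (Fin n)) :
    orderingCost (oneTailsInstance n) a = 3 - 4 / 2 ^ n := by
  have h := chain_add_chain_oneTailsInstance (l := List.ofFn a) (z := ⟨0, hn⟩)
    (List.nodup_ofFn.2 a.injective) rfl (List.mem_ofFn.2 (a.surjective _))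
  rw [List.length_ofFn] at h
  rw [orderingCost_eq_chain _ hn, h]
  ring

theorem optNonadaptive_oneTailsInstance {n : ℕ} (hn : 1 ≤ n) :
    optNonadaptive (oneTailsInstance n) = 3 - 4 / 2 ^ n := by
  simp only [optNonadaptive, orderingCost_oneTailsInstance hn, ciInf_const]

/-- Keeping the special coin for last, each fair coin preserves the bound, since `1 + 1 / 2 * 2 =
2`. -/
theorem oracleCost_tailProb_oneTailsInstance_le {n : ℕ} {S : Finset (Fin n)} {z : Fin n}
    (hz : z.val = 0) (hzS : z ∈ S) : oracleCost (tailProb (oneTailsInstance n)) S ≤ 2 := by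
  induction S using Finset.strongInduction with
  | H S ih =>
    rcases (S.erase z).eq_empty_or_nonempty with h0 | ⟨j, hj⟩
    · have h := oracleCost_le (p := tailProb (oneTailsInstance n)) hzS
      rw [h0, oracleCost_empty] at h
      linarith
    · have hjS := Finset.mem_of_mem_erase hj
      have hjz := Finset.ne_of_mem_erase hj
      have h := oracleCost_le (p := tailProb (oneTailsInstance n)) hjS
      have h' := ih _ (Finset.erase_ssubset hjS) (Finset.mem_erase.2 ⟨hjz.symm, hzS⟩)
      rw [tailProb_oneTailsInstance, if_neg fun h => hjz (Fin.ext (h.trans hz.symm))] at h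
      linarith

theorem optAdaptive_oneTailsInstance_le {n : ℕ} (hn : 1 ≤ n) :
    optAdaptive (oneTailsInstance n) ≤ 5 / 2 := by
  rcases hn.eq_or_lt with rfl | hn2
  · refine (optAdaptive_le_firstCost _ 0).trans ?_
    have h : (Finset.univ : Finset (Fin 1)).erase 0 = ∅ := by decide
    rw [firstCost, h, oracleCost_empty, oracleCost_empty]
    norm_num
  -- A fair coin goes first: after heads the coin `z` ends the process at once, after tails at most
  -- `2` more flips are expected.
  · set z : Fin n := ⟨0, hn⟩
    set i : Fin n := ⟨1, hn2⟩
    refine (optAdaptive_le_firstCost _ i).trans ?_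
    have hz : z ∈ (Finset.univ : Finset (Fin n)).erase i := by
      simp [z, i]
    have h1 := oracleCost_le (p := headProb (oneTailsInstance n)) hz
    rw [headProb_oneTailsInstance, if_pos rfl, zero_mul, add_zero] at h1
    have h2 := oracleCost_tailProb_oneTailsInstance_le rfl hz
    rw [firstCost, headProb_oneTailsInstance, tailProb_oneTailsInstance, if_neg (by simp [i]),
      if_neg (by simp [i])]
    linarith

theorem le_gapRatio_oneTailsInstance {n : ℕ} (hn : 1 ≤ n) :
    6 / 5 - 288 / 2 ^ n ≤ gapRatio (oneTailsInstance n) := by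
  have hAD := one_le_optAdaptive (oneTailsInstance n) hn
  have hpow : (4 : ℝ) / 2 ^ n ≤ 288 / 2 ^ n := by gcongr; norm_num
  have h4 : (4 : ℝ) / 2 ^ n ≤ 2 := by
    rw [div_le_iff₀ (by positivity)]
    have : (2 : ℝ) ^ 1 ≤ 2 ^ n := pow_le_pow_right₀ (by norm_num) hn
    linarith
  have h0 : (0 : ℝ) ≤ 4 / 2 ^ n := by positivity
  rw [gapRatio, optNonadaptive_oneTailsInstance hn]
  calc (6 : ℝ) / 5 - 288 / 2 ^ n ≤ (3 - 4 / 2 ^ n) / (5 / 2) := by linarith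
    _ ≤ _ := div_le_div_of_nonneg_left (by linarith) (by linarith)
      (optAdaptive_oneTailsInstance_le hn)

end Lower

end UnanimousVote

theorem mainTheorem5 :
    ∃ C : ℝ, ∀ n : ℕ, 1 ≤ n →
      BddAbove (Set.range fun p : Fin n → unitInterval => UnanimousVote.gapRatio p) ∧
      UnanimousVote.adaptivityGap n ≤ 6 / 5 + C / 2 ^ n ∧
      6 / 5 - C / 2 ^ n ≤ UnanimousVote.adaptivityGap n ∧
      6 / 5 - C / 2 ^ n ≤ UnanimousVote.gapRatio (UnanimousVote.oneTailsInstance n) := by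
  refine ⟨288, fun n hn => ?_⟩
  have hbdd : BddAbove (Set.range fun p : Fin n → unitInterval => UnanimousVote.gapRatio p) :=
    ⟨_, by rintro _ ⟨p, rfl⟩; exact UnanimousVote.gapRatio_le p hn⟩
  have hlow := UnanimousVote.le_gapRatio_oneTailsInstance hn
  exact ⟨hbdd, ciSup_le fun p => UnanimousVote.gapRatio_le p hn,
    hlow.trans (le_ciSup hbdd _), hlow⟩
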